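/- Let $M \in \mathbb{F}_2^{m\times n}$ be a matrix without zero columns (every variable occurs in at least one equation), and let $b, b' \in \mathbb{F}_2^m$ with $b \neq b'$. For $k \in [m]$ let $S_k = \{i \in [n] : M_{ki} = 1\}$. For $c \in \mathbb{F}_2^m$ let $G(M,c)$ be the following vertex- and edge-colored graph. Its vertices are the pairs $(k,\alpha)$ with $k\in[m]$ and $\alpha : S_k \to \{1,-1\}$ such that $\prod_{i \in S_k}\alpha_i = (-1)^{c_k}$; the color of $(k,\alpha)$ is $k$. Two distinct vertices $(l,\alpha)$, $(k,\beta)$ are adjacent if and only if $S_l \cap S_k \neq \varnothing$, and then the color of the edge is the function $S_l\cap S_k \to \{1,-1\}$, $i \mapsto \alpha_i\beta_i$. For colored graphs $G, G'$ with finite vertex sets and with vertex colorings $c, c'$, let $\mathrm{Iso}(G,G')$ be the universal unital $C^*$-algebra generated by elements $u_{gg'}$ ($g \in V(G)$, $g' \in V(G')$) subject to $u_{gg'}^2 = u_{gg'}^* = u_{gg'}$ for all $g, g'$; $\sum_{h\in V(G)} u_{hg'} = 1$ for every $g' \in V(G')$ and $\sum_{h' \in V(G')} u_{gh'} = 1$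 for every $g\in V(G)$; $u_{gg'} = 0$ if $c(g) \neq c'(g')$; and $A_{G_d}u = uA_{G'_d}$ for every edge color $d$, where $A_{G_d}$ is the adjacency matrix of the edges of $G$ of color $d$. For $c \in \mathbb{F}_2^m$ let $\mathcal{A}(M,c)$ be the universal unital $C^*$-algebra generated by elements $x_1,\dots,x_n$ subject to $x_i = x_i^*$ and $x_i^2 = 1$ for all $i$; $x_ix_j = x_jx_i$ whenever $i,j \in S_k$ for some $k$; and $\prod_{i\in S_k} x_i = (-1)^{c_k}$ for all $k\in[m]$. (Universal $C^*$-algebras may be zero.) Then there exists a $*$-isomorphism $\mathcal{A}(M,b+b') \cong \mathrm{Iso}(G(M,b),G(M,b'))$. -/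

import Mathlib

noncomputable section

/-! ### The free unital complex `*`-algebra -/

/-- The free unital complex `*`-algebra on the set `X`: noncommutative polynomials with complex
coefficients in the letters `x` (as `Sum.inl x`) and `x⋆` (as `Sum.inr x`), for `x` in `X`. -/
def FreeStarAlgebra (X : Type*) : Type _ := FreeAlgebra ℂ (X ⊕ X)

namespace FreeStarAlgebra

variable {X : Type*}

instance : Ring (FreeStarAlgebra X) := inferInstanceAs (Ring (FreeAlgebra ℂ (X ⊕ X)))

instance : Algebra ℂ (FreeStarAlgebra X) := inferInstanceAs (Algebra ℂ (FreeAlgebra ℂ (X ⊕ X)))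

/-- The letter of the free `*`-algebra that belongs to an element of `X ⊕ X`. -/
def letter (s : X ⊕ X) : FreeStarAlgebra X := FreeAlgebra.ι ℂ s

/-- The generator of the free `*`-algebra that belongs to `x`. -/
def gen (x : X) : FreeStarAlgebra X := letter (Sum.inl x)

theorem induction {P : FreeStarAlgebra X → Prop}
    (hc : ∀ c : ℂ, P (algebraMap ℂ (FreeStarAlgebra X) c)) (hl : ∀ s, P (letter s))
    (hm : ∀ a b, P a → P b → P (a * b)) (ha : ∀ a b, P a → P b → P (a + b))
    (a : FreeStarAlgebra X) : P a :=
  FreeAlgebra.induction ℂ (X ⊕ X) (motive := P) hc hl hm ha a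

/-- The opposite algebra, with the scalars acting through complex conjugation. -/
abbrev conjOpAlgebra : Algebra ℂ (FreeStarAlgebra X)ᵐᵒᵖ :=
  RingHom.toAlgebra' ((algebraMap ℂ (FreeStarAlgebra X)ᵐᵒᵖ).comp (starRingEnd ℂ))
    fun c x => Algebra.commutes (starRingEnd ℂ c) x

/-- The involution as a ring homomorphism to the opposite ring: it conjugates the scalars,
exchanges `x` and `x⋆`, and reverses products. -/
def starAux : FreeStarAlgebra X →+* (FreeStarAlgebra X)ᵐᵒᵖ :=
  letI := conjOpAlgebra (X := X)
  (FreeAlgebra.lift ℂ (fun s : X ⊕ X => MulOpposite.op (letter s.swap)) :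
    FreeAlgebra ℂ (X ⊕ X) →ₐ[ℂ] (FreeStarAlgebra X)ᵐᵒᵖ).toRingHom

theorem starAux_letter (s : X ⊕ X) : starAux (letter s) = MulOpposite.op (letter s.swap) := by
  let := conjOpAlgebra (X := X)
  exact FreeAlgebra.lift_ι_apply _ _

theorem starAux_algebraMap (c : ℂ) : starAux (algebraMap ℂ (FreeStarAlgebra X) c) =
    MulOpposite.op (algebraMap ℂ (FreeStarAlgebra X) (starRingEnd ℂ c)) := by
  let := conjOpAlgebra (X := X)
  exact AlgHom.commutes (FreeAlgebra.lift ℂ (fun s : X ⊕ X => MulOpposite.op (letter s.swap)) :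
    FreeAlgebra ℂ (X ⊕ X) →ₐ[ℂ] (FreeStarAlgebra X)ᵐᵒᵖ) c

instance : StarRing (FreeStarAlgebra X) where
  star a := (starAux a).unop
  star_involutive a := by
    induction a using induction with
    | hc c => simp [starAux_algebraMap]
    | hl s => simp [starAux_letter]
    | hm a b ha hb => simp [ha, hb]
    | ha a b ha hb => simp [ha, hb]
  star_mul a b := by simp
  star_add a b := by simp

theorem star_letter (s : X ⊕ X) : star (letter s) = letter s.swap :=
  congrArg MulOpposite.unop (starAux_letter s)

theorem star_algebraMap (c : ℂ) : star (algebraMap ℂ (FreeStarAlgebra X) c) =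
    algebraMap ℂ (FreeStarAlgebra X) (star c) :=
  congrArg MulOpposite.unop (starAux_algebraMap c)

instance : StarModule ℂ (FreeStarAlgebra X) where
  star_smul c a := by
    rw [Algebra.smul_def, star_mul, star_algebraMap, Algebra.smul_def, Algebra.commutes]

end FreeStarAlgebra

/-! ### Universal C⋆-algebras given by generators and relations -/

/-- A C⋆-seminorm on a complex `*`-algebra. -/
structure CStarSeminorm (A : Type*) [Ring A] [StarRing A] [Algebra ℂ A] extends
    Seminorm ℂ A where
  mul_le' : ∀ a b : A, toSeminorm (a * b) ≤ toSeminorm a * toSeminorm b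
  star_mul_self' : ∀ a : A, toSeminorm (star a * a) = toSeminorm a * toSeminorm a

namespace CStarSeminorm

variable {A : Type*} [Ring A] [StarRing A] [Algebra ℂ A] (p : CStarSeminorm A)

/-- The zero seminorm (it belongs to the `*`-homomorphism to the zero algebra). -/
def zero (A : Type*) [Ring A] [StarRing A] [Algebra ℂ A] : CStarSeminorm A where
  toSeminorm := 0
  mul_le' := by simp
  star_mul_self' := by simp

/-- The C⋆-seminorm `p` satisfies the relations `a = b`, for `R a b`. -/
def Respects (R : A → A → Prop) : Prop := ∀ a b, R a b → p.toSeminorm (a - b) = 0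

theorem le_star (a : A) : p.toSeminorm a ≤ p.toSeminorm (star a) := by
  have h := p.mul_le' (star a) a
  rw [p.star_mul_self'] at h
  rcases (apply_nonneg p.toSeminorm a).eq_or_lt with h0 | h0
  · rw [← h0]; exact apply_nonneg _ _
  · exact le_of_mul_le_mul_right h h0

theorem star_eq (a : A) : p.toSeminorm (star a) = p.toSeminorm a :=
  le_antisymm (by simpa using p.le_star (star a)) (p.le_star a)

theorem one_le_one : p.toSeminorm 1 ≤ 1 := by
  have h := p.star_mul_self' 1
  rw [star_one, mul_one] at h
  nlinarith [apply_nonneg p.toSeminorm 1]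

theorem eq_of_sub {a b : A} (h : p.toSeminorm (a - b) = 0) : p.toSeminorm a = p.toSeminorm b := by
  have h1 := abs_sub_map_le_sub p.toSeminorm a b
  rw [h] at h1
  exact sub_eq_zero.1 (abs_nonpos_iff.1 h1)

end CStarSeminorm

/-- Relations between generators indexed by `X`, as equations `a = b` (for `rel a b`) between
elements of the free `*`-algebra. They are required to be bounded, as they must be for a
universal C⋆-algebra to exist: each generator has bounded norm over all C⋆-seminorms
that satisfy the relations. -/
structure CStarRelations (X : Type*) where
  rel : FreeStarAlgebra X → FreeStarAlgebra X → Prop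
  bounded : ∀ x, ∃ C : ℝ, ∀ p : CStarSeminorm (FreeStarAlgebra X), p.Respects rel →
    p.toSeminorm (FreeStarAlgebra.gen x) ≤ C

/-- The free `*`-algebra, as the carrier of the universal C⋆-seminorm of the relations `R`. -/
def PreUniversal {X : Type*} (_R : CStarRelations X) : Type _ := FreeStarAlgebra X

namespace PreUniversal

variable {X : Type*} (R : CStarRelations X)

/-- The C⋆-seminorms that satisfy the relations. -/
abbrev Adm : Type _ := {p : CStarSeminorm (FreeStarAlgebra X) // p.Respects R.rel}

instance : Nonempty (Adm R) := ⟨⟨CStarSeminorm.zero _, fun _ _ _ => rfl⟩⟩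

instance instRing : Ring (PreUniversal R) := inferInstanceAs (Ring (FreeStarAlgebra X))
instance instAlgebra : Algebra ℂ (PreUniversal R) :=
  inferInstanceAs (Algebra ℂ (FreeStarAlgebra X))
instance instStarRing : StarRing (PreUniversal R) :=
  inferInstanceAs (StarRing (FreeStarAlgebra X))
instance instStarModule : StarModule ℂ (PreUniversal R) :=
  inferInstanceAs (StarModule ℂ (FreeStarAlgebra X))

theorem bddAbove (a : FreeStarAlgebra X) :
    BddAbove (Set.range fun p : Adm R => p.1.toSeminorm a) := by
  suffices h : ∃ C : ℝ, ∀ p : Adm R, p.1.toSeminorm a ≤ C by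
    obtain ⟨C, hC⟩ := h
    exact ⟨C, by rintro _ ⟨p, rfl⟩; exact hC p⟩
  induction a using FreeStarAlgebra.induction with
  | hc c =>
    refine ⟨‖c‖, fun p => ?_⟩
    rw [Algebra.algebraMap_eq_smul_one, map_smul_eq_mul]
    exact mul_le_of_le_one_right (norm_nonneg c) p.1.one_le_one
  | hl s =>
    rcases s with x | x
    · obtain ⟨C, hC⟩ := R.bounded x
      exact ⟨C, fun p => hC p.1 p.2⟩
    · obtain ⟨C, hC⟩ := R.bounded x
      refine ⟨C, fun p => ?_⟩
      rw [← p.1.star_eq, FreeStarAlgebra.star_letter]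
      exact hC p.1 p.2
  | hm a b ha hb =>
    obtain ⟨C, hC⟩ := ha
    obtain ⟨D, hD⟩ := hb
    exact ⟨C * D, fun p => (p.1.mul_le' a b).trans (mul_le_mul (hC p) (hD p)
      (apply_nonneg _ _) ((apply_nonneg _ _).trans (hC p)))⟩
  | ha a b ha hb =>
    obtain ⟨C, hC⟩ := ha
    obtain ⟨D, hD⟩ := hb
    exact ⟨C + D, fun p => (map_add_le_add _ _ _).trans (add_le_add (hC p) (hD p))⟩

/-- The universal C⋆-seminorm: the largest C⋆-seminorm that satisfies the relations. -/
def univNorm (a : FreeStarAlgebra X) : ℝ := ⨆ p : Adm R, p.1.toSeminorm a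

theorem le_univNorm (p : Adm R) (a : FreeStarAlgebra X) : p.1.toSeminorm a ≤ univNorm R a :=
  le_ciSup (bddAbove R a) p

theorem univNorm_nonneg (a : FreeStarAlgebra X) : 0 ≤ univNorm R a :=
  Real.iSup_nonneg fun _ => apply_nonneg _ _

/-- The universal C⋆-seminorm as a seminorm of additive groups. -/
def univAddSeminorm : AddGroupSeminorm (PreUniversal R) where
  toFun := univNorm R
  map_zero' := by
    refine (iSup_congr fun p : Adm R => map_zero p.1.toSeminorm).trans ?_
    simp
  add_le' a b := ciSup_le fun p => (map_add_le_add p.1.toSeminorm a b).trans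
    (add_le_add (le_univNorm R p a) (le_univNorm R p b))
  neg' a := iSup_congr fun p => map_neg_eq_map p.1.toSeminorm a

instance instSeminormedRing : SeminormedRing (PreUniversal R) where
  __ := instRing R
  __ := (univAddSeminorm R).toSeminormedAddCommGroup
  norm_mul_le a b := ciSup_le fun p => (p.1.mul_le' a b).trans
    (mul_le_mul (le_univNorm R p a) (le_univNorm R p b) (apply_nonneg _ _) (univNorm_nonneg R a))

theorem norm_def (a : PreUniversal R) : ‖a‖ = univNorm R a := rfl

instance instNormedAlgebra : NormedAlgebra ℂ (PreUniversal R) where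
  __ := instAlgebra R
  norm_smul_le c a := ciSup_le fun p => (map_smul_eq_mul p.1.toSeminorm c a).le.trans
    (mul_le_mul_of_nonneg_left (le_univNorm R p a) (norm_nonneg c))

theorem norm_star (a : PreUniversal R) : ‖star a‖ = ‖a‖ :=
  iSup_congr fun p => p.1.star_eq a

theorem mul_norm_le (a : PreUniversal R) : ‖a‖ * ‖a‖ ≤ ‖star a * a‖ := by
  have h : ‖a‖ ≤ √‖star a * a‖ := ciSup_le fun p => by
    refine Real.le_sqrt_of_sq_le ?_
    exact (sq _).le.trans ((p.1.star_mul_self' a).ge.trans (le_univNorm R p (star a * a)))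
  exact (mul_self_le_mul_self (norm_nonneg a) h).trans
    (Real.mul_self_sqrt (norm_nonneg _)).le

theorem isometry_star : Isometry (star : PreUniversal R → PreUniversal R) :=
  Isometry.of_dist_eq fun a b => by
    rw [dist_eq_norm, dist_eq_norm, ← star_sub, norm_star]

end PreUniversal

/-- The universal unital C⋆-algebra with the given generators and relations: the (Hausdorff)
completion of the free `*`-algebra in the universal C⋆-seminorm. -/
def UniversalCStarAlgebra {X : Type*} (R : CStarRelations X) : Type _ :=
  UniformSpace.Completion (PreUniversal R)

namespace UniversalCStarAlgebra

open UniformSpace (Completion)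

variable {X : Type*} (R : CStarRelations X)

instance instNormedRing : NormedRing (UniversalCStarAlgebra R) :=
  inferInstanceAs (NormedRing (Completion (PreUniversal R)))

instance instCompleteSpace : CompleteSpace (UniversalCStarAlgebra R) :=
  inferInstanceAs (CompleteSpace (Completion (PreUniversal R)))

instance instAlgebra : Algebra ℂ (UniversalCStarAlgebra R) :=
  inferInstanceAs (Algebra ℂ (Completion (PreUniversal R)))

instance instNormedAlgebra : NormedAlgebra ℂ (UniversalCStarAlgebra R) where
  __ := instAlgebra R
  norm_smul_le c a := norm_smul_le (β := Completion (PreUniversal R)) c a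

/-- The involution of the universal C⋆-algebra: the continuous extension of the involution of
the free `*`-algebra. -/
def starMap : UniversalCStarAlgebra R → UniversalCStarAlgebra R :=
  Completion.map (star : PreUniversal R → PreUniversal R)

theorem continuous_starMap : Continuous (starMap R) := Completion.continuous_map

/-- The canonical map from the free `*`-algebra. -/
def ofFree : PreUniversal R →+* UniversalCStarAlgebra R := Completion.coeRingHom

theorem ofFree_induction {P : UniversalCStarAlgebra R → Prop} (hP : IsClosed {a | P a})
    (h : ∀ a, P (ofFree R a)) (a : UniversalCStarAlgebra R) : P a :=
  Completion.induction_on a hP h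

theorem starMap_ofFree (a : PreUniversal R) : starMap R (ofFree R a) = ofFree R (star a) :=
  Completion.map_coe (PreUniversal.isometry_star R).uniformContinuous a

theorem smul_ofFree (c : ℂ) (a : PreUniversal R) : c • ofFree R a = ofFree R (c • a) :=
  (Completion.coe_smul c a).symm

theorem norm_ofFree (a : PreUniversal R) : ‖ofFree R a‖ = ‖a‖ := Completion.norm_coe a

instance instStarRing : StarRing (UniversalCStarAlgebra R) where
  star := starMap R
  star_involutive a := by
    refine ofFree_induction R (P := fun a => starMap R (starMap R a) = a) ?_ (fun a => ?_) a
    · exact isClosed_eq ((continuous_starMap R).comp (continuous_starMap R)) continuous_id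
    · rw [starMap_ofFree, starMap_ofFree, star_star]
  star_mul a b := by
    refine ofFree_induction R
      (P := fun a => starMap R (a * b) = starMap R b * starMap R a) ?_ (fun a => ?_) a
    · exact isClosed_eq ((continuous_starMap R).comp (continuous_id.mul continuous_const))
        (continuous_const.mul (continuous_starMap R))
    refine ofFree_induction R
      (P := fun b => starMap R (ofFree R a * b) = starMap R b * starMap R (ofFree R a))
      ?_ (fun b => ?_) b
    · exact isClosed_eq ((continuous_starMap R).comp (continuous_const.mul continuous_id))
        ((continuous_starMap R).mul continuous_const)
    · rw [← map_mul, starMap_ofFree, starMap_ofFree, starMap_ofFree, star_mul, map_mul]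
  star_add a b := by
    refine ofFree_induction R
      (P := fun a => starMap R (a + b) = starMap R a + starMap R b) ?_ (fun a => ?_) a
    · exact isClosed_eq ((continuous_starMap R).comp (continuous_id.add continuous_const))
        ((continuous_starMap R).add continuous_const)
    refine ofFree_induction R
      (P := fun b => starMap R (ofFree R a + b) = starMap R (ofFree R a) + starMap R b)
      ?_ (fun b => ?_) b
    · exact isClosed_eq ((continuous_starMap R).comp (continuous_const.add continuous_id))
        (continuous_const.add (continuous_starMap R))
    · rw [← map_add, starMap_ofFree, starMap_ofFree, starMap_ofFree, star_add, map_add]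

theorem star_ofFree (a : PreUniversal R) : star (ofFree R a) = ofFree R (star a) :=
  starMap_ofFree R a

instance instCStarAlgebra : CStarAlgebra (UniversalCStarAlgebra R) where
  __ := instNormedRing R
  __ := instStarRing R
  __ := instCompleteSpace R
  __ := instNormedAlgebra R
  norm_mul_self_le a := by
    refine ofFree_induction R (P := fun a => ‖a‖ * ‖a‖ ≤ ‖starMap R a * a‖) ?_ (fun a => ?_) a
    · exact isClosed_le (continuous_norm.mul continuous_norm)
        (((continuous_starMap R).mul continuous_id).norm)
    · rw [starMap_ofFree, ← map_mul, norm_ofFree, norm_ofFree]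
      exact PreUniversal.mul_norm_le R a
  star_smul c a := by
    refine ofFree_induction R (P := fun a => starMap R (c • a) = star c • starMap R a)
      ?_ (fun a => ?_) a
    · exact isClosed_eq ((continuous_starMap R).comp (continuous_const_smul c))
        ((continuous_starMap R).const_smul (star c))
    · rw [smul_ofFree, starMap_ofFree, starMap_ofFree, smul_ofFree, star_smul]

/-- The generators of the universal C⋆-algebra. -/
def gen (x : X) : UniversalCStarAlgebra R := ofFree R (FreeStarAlgebra.gen x)

end UniversalCStarAlgebra

/-! ### Colored graphs and the isomorphism algebra -/

/-- A colored graph on the vertex set `V`: a simple graph whose vertices and edges are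
colored by elements of `S`. -/
structure ColoredGraph (V S : Type*) where
  graph : SimpleGraph V
  vertexColor : V → S
  edgeColor : graph.edgeSet → S

namespace ColoredGraph

variable {V V' S : Type*}

/-- `v` and `w` are joined by an edge of color `c`. -/
def ColorAdj (G : ColoredGraph V S) (c : S) (v w : V) : Prop :=
  ∃ h : s(v, w) ∈ G.graph.edgeSet, G.edgeColor ⟨s(v, w), h⟩ = c

open Classical in
/-- The adjacency matrix of the edge color `c`. -/
def colorAdjMatrix (G : ColoredGraph V S) (c : S) (A : Type*) [Zero A] [One A] : Matrix V V A :=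
  Matrix.of fun v w => if G.ColorAdj c v w then 1 else 0

end ColoredGraph

section IsoAlgebra

variable {V V' S : Type*}

/-- The matrix of the generators `u g g'` in the free `*`-algebra. -/
def genMatrix (V V' : Type*) : Matrix V V' (FreeStarAlgebra (V × V')) :=
  Matrix.of fun g g' => FreeStarAlgebra.gen (g, g')

/-- The defining relations of the isomorphism algebra of two colored graphs. -/
inductive IsoRel [Fintype V] [Fintype V'] (G : ColoredGraph V S) (G' : ColoredGraph V' S) :
    FreeStarAlgebra (V × V') → FreeStarAlgebra (V × V') → Prop
  | mul_self (g : V) (g' : V') :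
      IsoRel G G' (genMatrix V V' g g' * genMatrix V V' g g') (genMatrix V V' g g')
  | star_self (g : V) (g' : V') :
      IsoRel G G' (star (genMatrix V V' g g')) (genMatrix V V' g g')
  | col_sum (g' : V') : IsoRel G G' (∑ h, genMatrix V V' h g') 1
  | row_sum (g : V) : IsoRel G G' (∑ h', genMatrix V V' g h') 1
  | vertex_color (g : V) (g' : V') (h : G.vertexColor g ≠ G'.vertexColor g') :
      IsoRel G G' (genMatrix V V' g g') 0
  | edge_color (c : S) (g : V) (g' : V') :
      IsoRel G G' ((G.colorAdjMatrix c (FreeStarAlgebra (V × V')) * genMatrix V V') g g')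
        ((genMatrix V V' * G'.colorAdjMatrix c (FreeStarAlgebra (V × V'))) g g')

/-- The relations of the isomorphism algebra; they are bounded since they make the generators
projections. -/
def isoRelations [Fintype V] [Fintype V'] (G : ColoredGraph V S) (G' : ColoredGraph V' S) :
    CStarRelations (V × V') where
  rel := IsoRel G G'
  bounded := by
    rintro ⟨g, g'⟩
    refine ⟨1, fun p hp => ?_⟩
    set u : FreeStarAlgebra (V × V') := FreeStarAlgebra.gen (g, g') with hu
    have h1 : p.toSeminorm (u * u - u) = 0 := hp _ _ (IsoRel.mul_self g g')
    have h2 : p.toSeminorm (star u - u) = 0 := hp _ _ (IsoRel.star_self g g')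
    have h3 : p.toSeminorm (star u * u - u * u) = 0 := by
      refine le_antisymm ?_ (apply_nonneg _ _)
      have := p.mul_le' (star u - u) u
      rwa [h2, zero_mul, sub_mul] at this
    have h4 := p.star_mul_self' u
    rw [p.eq_of_sub h3, p.eq_of_sub h1] at h4
    nlinarith [apply_nonneg p.toSeminorm u]

/-- The isomorphism algebra `Iso(G, G')` of two colored graphs with finite vertex sets. -/
abbrev IsoAlgebra [Fintype V] [Fintype V'] (G : ColoredGraph V S) (G' : ColoredGraph V' S) :
    Type _ :=
  UniversalCStarAlgebra (isoRelations G G')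

end IsoAlgebra

/-! ### Linear systems over the field with two elements -/

section LinearSystem

variable {m n : ℕ} (M : Matrix (Fin m) (Fin n) (ZMod 2)) (b : Fin m → ZMod 2)

/-- The set `S_k` of the variables that occur in equation `k`. -/
def eqSupport (k : Fin m) : Finset (Fin n) := Finset.univ.filter fun i => M k i = 1

/-- The set `±1^S_c` of the functions from `S` to `{1, -1}` with product `(-1)^c`. -/
abbrev SignFun (S : Finset (Fin n)) (c : ZMod 2) : Type :=
  {α : S → ℤˣ // ∏ i, α i = (-1) ^ c.val}

/-- The vertices `(k, α)` of `G(M, b)`. -/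
abbrev SystemVertex : Type := Σ k : Fin m, SignFun (eqSupport M k) (b k)

/-- The colors of `G(M, b)`: equations (for vertices), and functions from a set of variables
to `{1, -1}` (for edges). -/
abbrev SystemColor (m n : ℕ) : Type := Fin m ⊕ (Σ T : Finset (Fin n), (T → ℤˣ))

variable {M b}

/-- The function `α △ β` on `S_l ∩ S_k`, for vertices `(l, α)` and `(k, β)`. -/
def signProduct (v w : SystemVertex M b) : Σ T : Finset (Fin n), (T → ℤˣ) :=
  ⟨eqSupport M v.1 ∩ eqSupport M w.1, fun i =>
    v.2.1 ⟨i.1, (Finset.mem_inter.1 i.2).1⟩ * w.2.1 ⟨i.1, (Finset.mem_inter.1 i.2).2⟩⟩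

theorem signProduct_comm (v w : SystemVertex M b) : signProduct v w = signProduct w v := by
  have key : ∀ (T T' : Finset (Fin n)) (f : T → ℤˣ) (f' : T' → ℤˣ), T = T' →
      (∀ i h h', f ⟨i, h⟩ = f' ⟨i, h'⟩) →
      (⟨T, f⟩ : Σ T : Finset (Fin n), (T → ℤˣ)) = ⟨T', f'⟩ := by
    rintro T _ f f' rfl h
    exact congrArg _ (funext fun i : T => h i.1 i.2 i.2)
  exact key _ _ _ _ (Finset.inter_comm _ _) fun i h h' => mul_comm _ _

variable (M b)

/-- The colored graph `G(M, b)` of the linear system `M x = b`. -/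
def systemGraph : ColoredGraph (SystemVertex M b) (SystemColor m n) where
  graph :=
    { Adj := fun v w => v ≠ w ∧ (eqSupport M v.1 ∩ eqSupport M w.1).Nonempty
      symm := ⟨fun v w h => ⟨h.1.symm, by rw [Finset.inter_comm]; exact h.2⟩⟩
      loopless := ⟨fun _ h => h.1 rfl⟩ }
  vertexColor v := Sum.inl v.1
  edgeColor e := Sum.inr (Sym2.lift ⟨signProduct, signProduct_comm⟩ e.1)

/-- The defining relations of `A(M, b)`: the generators are self-adjoint with square `1`, those
that occur in a common equation commute, and the product of the variables of equation `k` (taken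
in increasing order, which is immaterial as they commute) is `(-1)^(b_k)`. -/
inductive SystemRel : FreeStarAlgebra (Fin n) → FreeStarAlgebra (Fin n) → Prop
  | star_self (i : Fin n) :
      SystemRel (star (FreeStarAlgebra.gen i)) (FreeStarAlgebra.gen i)
  | mul_self (i : Fin n) : SystemRel (FreeStarAlgebra.gen i * FreeStarAlgebra.gen i) 1
  | comm (k : Fin m) (i j : Fin n) (hi : M k i = 1) (hj : M k j = 1) :
      SystemRel (FreeStarAlgebra.gen i * FreeStarAlgebra.gen j)
        (FreeStarAlgebra.gen j * FreeStarAlgebra.gen i)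
  | prod (k : Fin m) :
      SystemRel (((eqSupport M k).sort (· ≤ ·)).map FreeStarAlgebra.gen).prod
        ((-1) ^ (b k).val)

/-- The relations of `A(M, b)`; they are bounded since they make the generators unitary. -/
def systemRelations : CStarRelations (Fin n) where
  rel := SystemRel M b
  bounded i := by
    refine ⟨1, fun p hp => ?_⟩
    set x : FreeStarAlgebra (Fin n) := FreeStarAlgebra.gen i with hx
    have h1 : p.toSeminorm (x * x - 1) = 0 := hp _ _ (SystemRel.mul_self i)
    have h2 : p.toSeminorm (star x - x) = 0 := hp _ _ (SystemRel.star_self i)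
    have h3 : p.toSeminorm (star x * x - x * x) = 0 := by
      refine le_antisymm ?_ (apply_nonneg _ _)
      have := p.mul_le' (star x - x) x
      rwa [h2, zero_mul, sub_mul] at this
    have h4 := p.star_mul_self' x
    rw [p.eq_of_sub h3, p.eq_of_sub h1] at h4
    nlinarith [apply_nonneg p.toSeminorm x, p.one_le_one]

/-- The universal C⋆-algebra `A(M, b)`. -/
abbrev SystemAlgebra : Type := UniversalCStarAlgebra (systemRelations M b)

end LinearSystem

end

/-! The proof matches, inside a single algebra, tuples `x` satisfying the relations of `A(M, b +
b')` with matrices `u` satisfying those of the isomorphism algebra. The link is `IsSpectral x u`: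
the entry of `u` at `(k, α)`, `(k, β)` is the joint spectral projection of the `x i`, `i ∈ S_k`, for
the eigenvalues `α i * β i`, and entries between different equations vanish.

From `x` to `u` (`IsSystemRep.exists_isSpectral`, `IsSpectral.isIsoRep`): for fixed `α`, the map `β
↦ α △ β` is a bijection onto the sign functions with product `(-1)^((b + b')_k)`. The product
relation kills all other joint projections, so rows sum to one, and likewise columns. Entries whose
signs differ at a common variable are orthogonal, which yields the edge relations.

From `u` to `x` (`IsIsoRep.exists_isSpectral`, `IsSpectral.isSystemRep`): put `x i = ∑ β, (α i * β
i) • u (k, α) (k, β)` for some vertex `(k, α)` with `i ∈ S_k`. The edge relations, in the form of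
`edge_relation_iff`, make this independent of the vertex.

Each of `x` and `u` determines the other (`tuple_unique`, `matrix_unique`), and `IsSpectral` is
preserved by homomorphisms. Hence the two maps obtained from the universal properties are mutually
inverse. -/

noncomputable section

/-! ### Universal properties of the free and the universal algebras. -/

namespace FreeStarAlgebra

variable {X B : Type*} [Ring B] [StarRing B] [Algebra ℂ B]

/-- The underlying algebra homomorphism of `FreeStarAlgebra.lift`. -/
def liftAux (f : X → B) : FreeStarAlgebra X →ₐ[ℂ] B :=
  (FreeAlgebra.lift ℂ (Sum.elim f fun x => star (f x)) : FreeAlgebra ℂ (X ⊕ X) →ₐ[ℂ] B)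

theorem liftAux_letter (f : X → B) (s : X ⊕ X) :
    liftAux f (letter s) = Sum.elim f (fun x => star (f x)) s :=
  FreeAlgebra.lift_ι_apply _ _

/-- The `*`-homomorphism from the free `*`-algebra with prescribed values on the generators. -/
def lift [StarModule ℂ B] (f : X → B) : FreeStarAlgebra X →⋆ₐ[ℂ] B where
  __ := liftAux f
  map_star' a := by
    change liftAux f (star a) = star (liftAux f a)
    induction a using induction with
    | hc c =>
      rw [star_algebraMap, AlgHom.commutes, AlgHom.commutes, algebraMap_star_comm]
    | hl s => rcases s with x | x <;> simp [star_letter, liftAux_letter]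
    | hm a b ha hb => simp [ha, hb]
    | ha a b ha hb => simp [ha, hb]

theorem lift_gen [StarModule ℂ B] (f : X → B) (x : X) : lift f (gen x) = f x :=
  liftAux_letter f (Sum.inl x)

theorem starAlgHom_ext {φ ψ : FreeStarAlgebra X →⋆ₐ[ℂ] B} (h : ∀ x, φ (gen x) = ψ (gen x)) :
    φ = ψ := by
  ext a
  induction a using induction with
  | hc c => rw [AlgHomClass.commutes, AlgHomClass.commutes]
  | hl s =>
    rcases s with x | x
    · exact h x
    · have hx : (letter (Sum.inr x) : FreeStarAlgebra X) = star (gen x) :=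
        (star_letter (Sum.inl x)).symm
      rw [hx, map_star, map_star, h]
  | hm a b ha hb => rw [map_mul, map_mul, ha, hb]
  | ha a b ha hb => rw [map_add, map_add, ha, hb]

end FreeStarAlgebra

/-- The C⋆-seminorm pulled back from the norm of a C⋆-algebra along a `*`-homomorphism. -/
def CStarSeminorm.comap {A B : Type*} [Ring A] [StarRing A] [Algebra ℂ A] [CStarAlgebra B]
    (φ : A →⋆ₐ[ℂ] B) : CStarSeminorm A where
  toSeminorm := (normSeminorm ℂ B).comp φ.toAlgHom.toLinearMap
  mul_le' a b := by
    change ‖φ (a * b)‖ ≤ ‖φ a‖ * ‖φ b‖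
    rw [map_mul]
    exact norm_mul_le _ _
  star_mul_self' a := by
    change ‖φ (star a * a)‖ = ‖φ a‖ * ‖φ a‖
    rw [map_mul, map_star, CStarRing.norm_star_mul_self]

namespace UniversalCStarAlgebra

variable {X : Type*} (R : CStarRelations X) {B : Type*} [CStarAlgebra B]

theorem algebraMap_eq_ofFree (c : ℂ) :
    algebraMap ℂ (UniversalCStarAlgebra R) c = ofFree R (algebraMap ℂ (PreUniversal R) c) := by
  rw [Algebra.algebraMap_eq_smul_one, Algebra.algebraMap_eq_smul_one, ← smul_ofFree, map_one]

/-- The canonical `*`-homomorphism from the free `*`-algebra. -/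
def ofFreeHom : FreeStarAlgebra X →⋆ₐ[ℂ] UniversalCStarAlgebra R where
  toFun := ofFree R
  map_one' := map_one (ofFree R)
  map_mul' := map_mul (ofFree R)
  map_zero' := map_zero (ofFree R)
  map_add' := map_add (ofFree R)
  commutes' c := (algebraMap_eq_ofFree R c).symm
  map_star' a := (star_ofFree R a).symm

theorem ofFreeHom_eq_of_rel {a b : FreeStarAlgebra X} (h : R.rel a b) :
    ofFreeHom R a = ofFreeHom R b := by
  rw [← sub_eq_zero, ← map_sub, ← norm_eq_zero]
  refine (norm_ofFree R (a - b : FreeStarAlgebra X)).trans ?_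
  refine (iSup_congr fun p : PreUniversal.Adm R => p.2 a b h).trans ?_
  simp

variable {R}

/-- The norm of `B` pulled back along `φ` is one of the seminorms in the supremum that defines the
universal one. -/
theorem norm_le_of_respects (φ : FreeStarAlgebra X →⋆ₐ[ℂ] B)
    (hφ : ∀ a b, R.rel a b → φ a = φ b) (a : PreUniversal R) :
    ‖φ a‖ ≤ ‖a‖ := by
  refine PreUniversal.le_univNorm R ⟨CStarSeminorm.comap φ, fun c d h => ?_⟩ a
  change ‖φ (c - d)‖ = 0
  rw [map_sub, hφ c d h, sub_self, norm_zero]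

/-- A `*`-homomorphism from the free `*`-algebra, as a ring homomorphism from the seminormed
ring whose completion is the universal C⋆-algebra. -/
def preHom (φ : FreeStarAlgebra X →⋆ₐ[ℂ] B) : PreUniversal R →+* B where
  toFun := φ
  map_one' := map_one φ
  map_mul' := map_mul φ
  map_zero' := map_zero φ
  map_add' := map_add φ

/-- The underlying ring homomorphism of `UniversalCStarAlgebra.lift`. -/
def liftRingHom (φ : FreeStarAlgebra X →⋆ₐ[ℂ] B) (hφ : ∀ a b, R.rel a b → φ a = φ b) :
    UniversalCStarAlgebra R →+* B :=
  UniformSpace.Completion.extensionHom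
    (preHom φ)
    (AddMonoidHomClass.continuous_of_bound (preHom φ : PreUniversal R →+* B) 1
      fun a => by rw [one_mul]; exact norm_le_of_respects φ hφ a)

theorem continuous_liftRingHom (φ : FreeStarAlgebra X →⋆ₐ[ℂ] B)
    (hφ : ∀ a b, R.rel a b → φ a = φ b) : Continuous (liftRingHom φ hφ) :=
  UniformSpace.Completion.continuous_extension

theorem liftRingHom_ofFree (φ : FreeStarAlgebra X →⋆ₐ[ℂ] B)
    (hφ : ∀ a b, R.rel a b → φ a = φ b) (a : PreUniversal R) :
    liftRingHom φ hφ (ofFree R a) = φ a :=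
  UniformSpace.Completion.extensionHom_coe _ _ a

/-- The universal property: a `*`-homomorphism from the free `*`-algebra to a C⋆-algebra that
satisfies the relations extends to the universal C⋆-algebra. -/
def lift (φ : FreeStarAlgebra X →⋆ₐ[ℂ] B) (hφ : ∀ a b, R.rel a b → φ a = φ b) :
    UniversalCStarAlgebra R →⋆ₐ[ℂ] B where
  __ := liftRingHom φ hφ
  commutes' c := by
    change liftRingHom φ hφ (algebraMap ℂ _ c) = _
    rw [algebraMap_eq_ofFree, liftRingHom_ofFree]
    exact AlgHomClass.commutes φ c
  map_star' a := by
    change liftRingHom φ hφ (star a) = star (liftRingHom φ hφ a)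
    refine ofFree_induction R
      (P := fun a => liftRingHom φ hφ (starMap R a) = star (liftRingHom φ hφ a)) ?_ (fun a => ?_) a
    · exact isClosed_eq ((continuous_liftRingHom φ hφ).comp (continuous_starMap R))
        (continuous_star.comp (continuous_liftRingHom φ hφ))
    · rw [starMap_ofFree, liftRingHom_ofFree, liftRingHom_ofFree]
      exact map_star φ a

theorem lift_gen (φ : FreeStarAlgebra X →⋆ₐ[ℂ] B) (hφ : ∀ a b, R.rel a b → φ a = φ b) (x : X) :
    lift φ hφ (gen R x) = φ (FreeStarAlgebra.gen x) :=
  liftRingHom_ofFree φ hφ _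

theorem starAlgHom_ext {φ ψ : UniversalCStarAlgebra R →⋆ₐ[ℂ] B}
    (h : ∀ x, φ (gen R x) = ψ (gen R x)) : φ = ψ := by
  have hfree : φ.comp (ofFreeHom R) = ψ.comp (ofFreeHom R) := FreeStarAlgebra.starAlgHom_ext h
  -- `*`-homomorphisms of C⋆-algebras are contractive, so agreement on the dense image of the free
  -- algebra suffices.
  have hcont : ∀ χ : UniversalCStarAlgebra R →⋆ₐ[ℂ] B, Continuous χ := fun χ =>
    AddMonoidHomClass.continuous_of_bound χ 1 fun a => by
      rw [one_mul]; exact NonUnitalStarAlgHom.norm_apply_le χ a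
  ext a
  refine ofFree_induction R (P := fun a => φ a = ψ a) (isClosed_eq (hcont φ) (hcont ψ))
    (fun a => ?_) a
  exact DFunLike.congr_fun hfree a

end UniversalCStarAlgebra

/-! ### Signs as eigenvalues and joint spectral projections. -/

section Signs

variable {B : Type*} [Ring B]

theorem neg_one_pow_val_add (a b : ZMod 2) :
    (-1 : ℤˣ) ^ (a + b).val = (-1) ^ a.val * (-1) ^ b.val := by
  revert a b
  decide

theorem Int.units_smul_one_neg_one_pow (k : ℕ) : ((-1 : ℤˣ) ^ k) • (1 : B) = (-1) ^ k := by
  simp [Units.smul_def]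

theorem Int.units_smul_smul_self (s : ℤˣ) (a : B) : s • s • a = a := by
  rw [smul_smul, Int.units_mul_self, one_smul]

theorem list_prod_mul_eq_smul {ι : Type*} {x : ι → B} {p : B} {s : ι → ℤˣ} (l : List ι)
    (h : ∀ i ∈ l, x i * p = s i • p) : (l.map x).prod * p = (l.map s).prod • p := by
  induction l with
  | nil => simp
  | cons i l ih =>
    rw [List.map_cons, List.prod_cons, mul_assoc, ih fun j hj => h j (List.mem_cons_of_mem _ hj),
      mul_smul_comm, h i List.mem_cons_self, smul_smul, List.map_cons, List.prod_cons, mul_comm]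

variable [Algebra ℂ B]

/-- Distinct signs are opposite, so the equation says `a = -a`; a complex algebra has no 2-torsion.
-/
theorem Int.units_smul_eq_iff_of_ne {a : B} {s t : ℤˣ} (h : s ≠ t) : s • a = t • a ↔ a = 0 := by
  let : Module ℚ B := Module.compHom B (algebraMap ℚ ℂ)
  have : IsAddTorsionFree B := .of_module_rat B
  constructor
  · intro hst
    rcases Int.units_eq_one_or s with rfl | rfl <;> rcases Int.units_eq_one_or t with rfl | rfl
    · exact absurd rfl h
    · simpa [Units.smul_def, self_eq_neg] using hst
    · simpa [Units.smul_def, neg_eq_self] using hst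
    · exact absurd rfl h
  · rintro rfl
    simp

/-- Eigenvectors of `a` for different signs are orthogonal. -/
theorem mul_eq_zero_of_sign_ne {a p q : B} {s t : ℤˣ} (hp : p * a = s • p) (hq : a * q = t • q)
    (h : s ≠ t) : p * q = 0 := by
  rw [← Int.units_smul_eq_iff_of_ne h, ← smul_mul_assoc, ← hp, mul_assoc, hq, mul_smul_comm]

/-- The joint spectral projections of finitely many commuting elements with square one. -/
theorem exists_joint_spectral {ι : Type*} [Fintype ι] [DecidableEq ι] (x : ι → B)
    (hx : ∀ i, x i * x i = 1)
    (hcomm : ∀ i j, x i * x j = x j * x i) :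
    ∃ P : (ι → ℤˣ) → B, (∀ i s, x i * P s = s i • P s) ∧ (∀ i s, P s * x i = s i • P s) ∧
      ∑ s, P s = 1 := by
  -- Products over `ι` need a commutative ring: the subalgebra generated by the `x i`.
  have : IsMulCommutative (Algebra.adjoin ℂ (Set.range x)) := Algebra.isMulCommutative_adjoin ℂ (by
    rintro _ ⟨i, rfl⟩ _ ⟨j, rfl⟩; exact hcomm i j)
  let : CommRing (Algebra.adjoin ℂ (Set.range x)) :=
    { (inferInstance : Ring (Algebra.adjoin ℂ (Set.range x))) with mul_comm := mul_comm' }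
  let y : ι → Algebra.adjoin ℂ (Set.range x) := fun i =>
    ⟨x i, Algebra.subset_adjoin ⟨i, rfl⟩⟩
  have hy : ∀ i, y i * y i = 1 := fun i => Subtype.ext (hx i)
  -- The spectral projection of `x i` for the eigenvalue `s`.
  let e : ι → ℤˣ → Algebra.adjoin ℂ (Set.range x) := fun i s =>
    (1 / 2 : ℂ) • (1 + s • y i)
  have he : ∀ i s, y i * e i s = s • e i s := fun i s => by
    simp only [e, mul_smul_comm, mul_add, mul_one, hy, smul_comm s (1 / 2 : ℂ), smul_add,
      Int.units_smul_smul_self]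
    rw [add_comm]
  have hP : ∀ i (s : ι → ℤˣ), y i * ∏ j, e j (s j) = s i • ∏ j, e j (s j) := fun i s => by
    rw [← Finset.mul_prod_erase _ _ (Finset.mem_univ i), ← mul_assoc, he, smul_mul_assoc]
  have hsum : ∑ s : ι → ℤˣ, ∏ j, e j (s j) = 1 := by
    -- The sum over all sign functions is the expansion of `∏ i, (e i 1 + e i (-1))`, whose factors
    -- are all one.
    rw [← Fintype.prod_sum]
    refine Finset.prod_eq_one fun i _ => ?_
    have huniv : (Finset.univ : Finset ℤˣ) = {1, -1} := rfl
    rw [huniv, Finset.sum_pair (by decide)]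
    simp only [e, ← smul_add, Units.smul_def]
    module
  refine ⟨fun s => ((∏ j, e j (s j) : Algebra.adjoin ℂ (Set.range x)) : B), fun i s => ?_,
    fun i s => ?_, ?_⟩
  · exact congrArg Subtype.val (hP i s)
  · exact congrArg Subtype.val ((mul_comm _ _).trans (hP i s))
  · have := congrArg (Algebra.adjoin ℂ (Set.range x)).val hsum
    rw [map_sum, map_one] at this
    exact this

end Signs

/-! ### Orthogonality of projections. -/

section Projections

/-- Projections in a C⋆-algebra that add up to one are pairwise orthogonal. -/
theorem mul_eq_zero_of_sum_eq_one {B ι : Type*} [CStarAlgebra B] [Fintype ι] {p : ι → B}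
    (hidem : ∀ i, p i * p i = p i) (hstar : ∀ i, star (p i) = p i) (hsum : ∑ i, p i = 1)
    {i j : ι} (hij : i ≠ j) : p i * p j = 0 := by
  classical
  let := CStarAlgebra.spectralOrder B
  have := CStarAlgebra.spectralOrderedRing B
  have hsq : ∀ k, star (p k * p j) * (p k * p j) = p j * p k * p j := fun k => by
    rw [star_mul, hstar, hstar, mul_assoc, ← mul_assoc (p k), hidem, mul_assoc]
  have htotal : ∑ k, p j * p k * p j = p j := by
    rw [← Finset.sum_mul, ← Finset.mul_sum, hsum, mul_one, hidem]
  -- The term `k = j` is already `p j`, so the remaining terms, all positive by `hsq`, sum to zero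
  -- and vanish one by one.
  rw [← Finset.add_sum_erase _ _ (Finset.mem_univ j), hidem, hidem, add_eq_left] at htotal
  have hzero := (Finset.sum_eq_zero_iff_of_nonneg fun k _ => by
    rw [← hsq]; exact star_mul_self_nonneg _).1 htotal i
    (Finset.mem_erase.2 ⟨hij, Finset.mem_univ _⟩)
  rw [← hsq] at hzero
  exact CStarRing.star_mul_self_eq_zero_iff _ |>.1 hzero

end Projections

theorem ColoredGraph.colorAdjMatrix_map {V S A B F : Type*} {G : ColoredGraph V S} [Ring A] [Ring B]
    [FunLike F A B] [RingHomClass F A B]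
    (φ : F) (c : S) : (G.colorAdjMatrix c A).map φ = G.colorAdjMatrix c B := by
  ext v w
  simp only [colorAdjMatrix, Matrix.map_apply, Matrix.of_apply, apply_ite φ, map_one, map_zero]

/-! ### Signs attached to vertices and to pairs of vertices. -/

section SignMatrix

variable {m n : ℕ} {M : Matrix (Fin m) (Fin n) (ZMod 2)} {b b' : Fin m → ZMod 2}

/-- The sign that a vertex `(k, α)` gives to a variable: `α i` on the support of equation `k`,
and `1` elsewhere. -/
def vertexSign (g : SystemVertex M b) (i : Fin n) : ℤˣ :=
  if h : i ∈ eqSupport M g.1 then g.2.1 ⟨i, h⟩ else 1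

theorem vertexSign_coe (g : SystemVertex M b) (i : eqSupport M g.1) :
    vertexSign g i = g.2.1 i := dif_pos i.2

theorem prod_vertexSign (g : SystemVertex M b) :
    ∏ i ∈ eqSupport M g.1, vertexSign g i = (-1) ^ (b g.1).val := by
  rw [← Finset.prod_coe_sort, ← g.2.2]
  exact Finset.prod_congr rfl fun i _ => vertexSign_coe g i

theorem systemVertex_ext {g h : SystemVertex M b} (hk : g.1 = h.1)
    (hs : ∀ i ∈ eqSupport M g.1, vertexSign g i = vertexSign h i) : g = h := by
  obtain ⟨k, α⟩ := g
  obtain ⟨l, β⟩ := h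
  obtain rfl : k = l := hk
  refine congrArg _ (Subtype.ext (funext fun i => ?_))
  have := hs i i.2
  rwa [vertexSign_coe ⟨k, α⟩, vertexSign_coe ⟨k, β⟩] at this

/-- A single variable can carry the whole sign `(-1)^(b k)`. An empty equation has a vertex only if
`b k = 0`, since the empty product is one. -/
theorem exists_systemVertex (b : Fin m → ZMod 2) {k : Fin m}
    (h : (eqSupport M k).Nonempty ∨ b k = 0) : ∃ g : SystemVertex M b, g.1 = k := by
  classical
  by_cases hne : (eqSupport M k).Nonempty
  · obtain ⟨i, hi⟩ := hne
    exact ⟨⟨k, Pi.mulSingle ⟨i, hi⟩ ((-1) ^ (b k).val), by rw [Fintype.prod_pi_mulSingle']⟩, rfl⟩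
  · have hk : b k = 0 := h.resolve_left hne
    have : IsEmpty (eqSupport M k) := by
      rw [Finset.not_nonempty_iff_eq_empty.1 hne]; infer_instance
    exact ⟨⟨k, fun _ => 1, by simp [hk]⟩, rfl⟩

theorem signProduct_eq_iff {g h : SystemVertex M b} {g' h' : SystemVertex M b'}
    (hg : g.1 = g'.1) (hh : h.1 = h'.1) :
    signProduct g h = signProduct g' h' ↔ ∀ i ∈ eqSupport M g.1, i ∈ eqSupport M h.1 →
      vertexSign g i * vertexSign h i = vertexSign g' i * vertexSign h' i := by
  obtain ⟨k, α⟩ := g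
  obtain ⟨l, β⟩ := h
  obtain ⟨k', α'⟩ := g'
  obtain ⟨l', β'⟩ := h'
  obtain rfl : k = k' := hg
  obtain rfl : l = l' := hh
  simp only [signProduct, Sigma.mk.injEq, heq_eq_eq, true_and, funext_iff, Subtype.forall,
    Finset.mem_inter, vertexSign]
  constructor
  · intro H i hi hj
    have := H i ⟨hi, hj⟩
    simpa only [dif_pos hi, dif_pos hj] using this
  · rintro H i ⟨hi, hj⟩
    have := H i hi hj
    simpa only [dif_pos hi, dif_pos hj] using this

theorem colorAdj_systemGraph_iff {c : SystemColor m n} {g h : SystemVertex M b} :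
    (systemGraph M b).ColorAdj c g h ↔
      (g ≠ h ∧ (eqSupport M g.1 ∩ eqSupport M h.1).Nonempty) ∧ Sum.inr (signProduct g h) = c :=
  ⟨fun ⟨h, e⟩ => ⟨h, e⟩, fun ⟨h, e⟩ => ⟨h, e⟩⟩

/-- The sign by which the variable `i` acts on the entry `(g, g')` of a spectral matrix. -/
def entrySign (g : SystemVertex M b) (g' : SystemVertex M b') (i : Fin n) : ℤˣ :=
  vertexSign g i * vertexSign g' i

theorem entrySign_left_injective {g h : SystemVertex M b} {g' : SystemVertex M b'}
    (hg : g.1 = g'.1) (hh : h.1 = g'.1)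
    (hs : ∀ i ∈ eqSupport M g.1, entrySign g g' i = entrySign h g' i) : g = h :=
  systemVertex_ext (hg.trans hh.symm) fun i hi => mul_right_cancel (hs i hi)

theorem entrySign_right_injective {g : SystemVertex M b} {g' h' : SystemVertex M b'}
    (hg : g.1 = g'.1) (hh : g.1 = h'.1)
    (hs : ∀ i ∈ eqSupport M g.1, entrySign g g' i = entrySign g h' i) : g' = h' :=
  systemVertex_ext (hg.symm.trans hh) fun i hi => mul_left_cancel (hs i (hg ▸ hi))

/-- This is the source of the right-hand side `b + b'`. -/
theorem prod_entrySign {g : SystemVertex M b} {g' : SystemVertex M b'} (h : g.1 = g'.1) :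
    ∏ i ∈ eqSupport M g.1, entrySign g g' i = (-1) ^ ((b + b') g.1).val := by
  simp only [entrySign, Finset.prod_mul_distrib, prod_vertexSign, Pi.add_apply,
    neg_one_pow_val_add]
  congr 1
  rw [h, prod_vertexSign]

end SignMatrix

/-! ### Representations of the two sets of relations. -/

section Reps

variable {m n : ℕ} {M : Matrix (Fin m) (Fin n) (ZMod 2)} {b b' : Fin m → ZMod 2}
variable {B C : Type*}

/-- The tuple `x` satisfies the relations of `A(M, c)`. -/
structure IsSystemRep [Ring B] [Star B] (M : Matrix (Fin m) (Fin n) (ZMod 2))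
    (c : Fin m → ZMod 2) (x : Fin n → B) : Prop where
  star_self (i : Fin n) : star (x i) = x i
  mul_self (i : Fin n) : x i * x i = 1
  comm (k : Fin m) (i j : Fin n) (hi : M k i = 1) (hj : M k j = 1) : x i * x j = x j * x i
  prod (k : Fin m) : (((eqSupport M k).sort (· ≤ ·)).map x).prod = (-1) ^ (c k).val

/-- The matrix `u` satisfies the relations of `Iso(G, G')`. -/
structure IsIsoRep {V V' S : Type*} [Fintype V] [Fintype V'] [Ring B] [Star B]
    (G : ColoredGraph V S) (G' : ColoredGraph V' S) (u : Matrix V V' B) : Prop where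
  mul_self (g : V) (g' : V') : u g g' * u g g' = u g g'
  star_self (g : V) (g' : V') : star (u g g') = u g g'
  col_sum (g' : V') : ∑ h, u h g' = 1
  row_sum (g : V) : ∑ h', u g h' = 1
  vertex_color (g : V) (g' : V') (h : G.vertexColor g ≠ G'.vertexColor g') : u g g' = 0
  edge_color (c : S) (g : V) (g' : V') :
    (G.colorAdjMatrix c B * u) g g' = (u * G'.colorAdjMatrix c B) g g'

/-- The matrix `u` consists of joint spectral projections of the `x i`: the entry at
`(k, α)`, `(k, β)` belongs to the eigenvalue `α i * β i` of `x i`, for `i` in equation `k`. -/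
structure IsSpectral [Ring B] (x : Fin n → B)
    (u : Matrix (SystemVertex M b) (SystemVertex M b') B) : Prop where
  eq_zero (g : SystemVertex M b) (g' : SystemVertex M b') (h : g.1 ≠ g'.1) : u g g' = 0
  mul_left (g : SystemVertex M b) (g' : SystemVertex M b') (i : Fin n)
    (hi : i ∈ eqSupport M g.1) : x i * u g g' = entrySign g g' i • u g g'
  mul_right (g : SystemVertex M b) (g' : SystemVertex M b') (i : Fin n)
    (hi : i ∈ eqSupport M g.1) : u g g' * x i = entrySign g g' i • u g g'
  col_sum (g' : SystemVertex M b') : ∑ h, u h g' = 1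
  row_sum (g : SystemVertex M b) : ∑ h', u g h' = 1

section Relations

variable [Ring B] [StarRing B] [Algebra ℂ B]

theorem isSystemRep_iff (c : Fin m → ZMod 2) (φ : FreeStarAlgebra (Fin n) →⋆ₐ[ℂ] B) :
    IsSystemRep M c (fun i => φ (FreeStarAlgebra.gen i)) ↔
      ∀ p q, SystemRel M c p q → φ p = φ q := by
  constructor
  · rintro h _ _ (i | i | ⟨k, i, j, hi, hj⟩ | k)
    · rw [map_star, h.star_self]
    · rw [map_mul, map_one, h.mul_self]
    · rw [map_mul, map_mul, h.comm k i j hi hj]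
    · rw [map_list_prod, List.map_map, map_pow, map_neg, map_one, ← h.prod k]
      rfl
  · intro h
    refine ⟨fun i => ?_, fun i => ?_, fun k i j hi hj => ?_, fun k => ?_⟩
    · simpa only [map_star] using h _ _ (.star_self i)
    · simpa only [map_mul, map_one] using h _ _ (.mul_self i)
    · simpa only [map_mul] using h _ _ (.comm k i j hi hj)
    · have := h _ _ (.prod k)
      rw [map_list_prod, List.map_map, map_pow, map_neg, map_one] at this
      exact this

variable {V V' S : Type*} [Fintype V] [Fintype V'] {G : ColoredGraph V S} {G' : ColoredGraph V' S}

theorem isIsoRep_iff (φ : FreeStarAlgebra (V × V') →⋆ₐ[ℂ] B) :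
    IsIsoRep G G' ((genMatrix V V').map φ) ↔ ∀ p q, IsoRel G G' p q → φ p = φ q := by
  have hl : ∀ c g g', φ ((G.colorAdjMatrix c (FreeStarAlgebra (V × V')) * genMatrix V V') g g') =
      (G.colorAdjMatrix c B * (genMatrix V V').map φ) g g' := fun c g g' => by
    rw [← ColoredGraph.colorAdjMatrix_map φ, ← Matrix.map_mul, Matrix.map_apply]
  have hr : ∀ c g g', φ ((genMatrix V V' * G'.colorAdjMatrix c (FreeStarAlgebra (V × V'))) g g') =
      ((genMatrix V V').map φ * G'.colorAdjMatrix c B) g g' := fun c g g' => by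
    rw [← ColoredGraph.colorAdjMatrix_map φ, ← Matrix.map_mul, Matrix.map_apply]
  constructor
  · rintro h _ _ (⟨g, g'⟩ | ⟨g, g'⟩ | g' | g | ⟨g, g', hne⟩ | ⟨c, g, g'⟩)
    · rw [map_mul]; exact h.mul_self g g'
    · rw [map_star]; exact h.star_self g g'
    · rw [map_sum, map_one]; exact h.col_sum g'
    · rw [map_sum, map_one]; exact h.row_sum g
    · rw [map_zero]; exact h.vertex_color g g' hne
    · rw [hl, hr]; exact h.edge_color c g g'
  · intro h
    refine ⟨fun g g' => ?_, fun g g' => ?_, fun g' => ?_, fun g => ?_, fun g g' hne => ?_,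
      fun c g g' => ?_⟩
    · simpa only [map_mul, Matrix.map_apply] using h _ _ (.mul_self g g')
    · simpa only [map_star, Matrix.map_apply] using h _ _ (.star_self g g')
    · simpa only [map_sum, map_one, Matrix.map_apply] using h _ _ (.col_sum g')
    · simpa only [map_sum, map_one, Matrix.map_apply] using h _ _ (.row_sum g)
    · simpa only [map_zero, Matrix.map_apply] using h _ _ (.vertex_color g g' hne)
    · rw [← hl, ← hr]; exact h _ _ (.edge_color c g g')

end Relations

end Reps

/-- Both equations say `r * s * t * v = 1`. This trades equality of edge colors (signs within each
graph) for equality of entry signs (across the graphs). -/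
theorem Int.units_mul_exchange : ∀ r s t v : ℤˣ, r * s = t * v → t * r = v * s := by decide

/-! ### Edge relations as orthogonality. -/

section EdgeRelation

variable {V V' S B : Type*} [Fintype V] [Fintype V'] [Ring B]
  {G : ColoredGraph V S} {G' : ColoredGraph V' S} {u : Matrix V V' B}

/-- For a matrix of projections whose rows and columns add up to one, the edge relations say that
entries at pairs of vertices joined by differently colored edges are orthogonal. -/
theorem edge_relation_iff (hcol : ∀ g', ∑ h, u h g' = 1) (hrow : ∀ g, ∑ h', u g h' = 1)
    (hidem : ∀ g g', u g g' * u g g' = u g g')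
    (hcol_orth : ∀ g h g', g ≠ h → u g g' * u h g' = 0)
    (hrow_orth : ∀ g g' h', g' ≠ h' → u g g' * u g h' = 0) (c : S) :
    (∀ g g', (G.colorAdjMatrix c B * u) g g' = (u * G'.colorAdjMatrix c B) g g') ↔
      ∀ g g' h h', u h g' * u g h' ≠ 0 → (G.ColorAdj c g h ↔ G'.ColorAdj c h' g') := by
  classical
  have hleft : ∀ g g', (G.colorAdjMatrix c B * u) g g' =
      ∑ h, if G.ColorAdj c g h then u h g' else 0 := fun g g' => by
    simp only [Matrix.mul_apply, ColoredGraph.colorAdjMatrix, Matrix.of_apply, ite_mul, one_mul,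
      zero_mul]
  have hright : ∀ g g', (u * G'.colorAdjMatrix c B) g g' =
      ∑ h', if G'.ColorAdj c h' g' then u g h' else 0 := fun g g' => by
    simp only [Matrix.mul_apply, ColoredGraph.colorAdjMatrix, Matrix.of_apply, mul_ite, mul_one,
      mul_zero]
  have hmul_left : ∀ g g' h, u h g' * (∑ k, if G.ColorAdj c g k then u k g' else 0) =
      if G.ColorAdj c g h then u h g' else 0 := fun g g' h => by
    rw [Finset.mul_sum, Finset.sum_eq_single h]
    · rw [mul_ite, hidem, mul_zero]
    · intro k _ hk
      rw [mul_ite, hcol_orth h k g' hk.symm, mul_zero, ite_self]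
    · simp
  have hmul_right : ∀ g g' h', (∑ k', if G'.ColorAdj c k' g' then u g k' else 0) * u g h' =
      if G'.ColorAdj c h' g' then u g h' else 0 := fun g g' h' => by
    rw [Finset.sum_mul, Finset.sum_eq_single h']
    · rw [ite_mul, hidem, zero_mul]
    · intro k' _ hk
      rw [ite_mul, hrow_orth g k' h' hk, zero_mul, ite_self]
    · simp
  simp only [hleft, hright]
  constructor
  · intro H g g' h h' hne
    -- The left factor isolates the summand `h` of the column sum, the right factor the summand `h'`
    -- of the row sum.
    have key := congrArg (fun a => u h g' * a * u g h') (H g g')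
    simp only [hmul_left, mul_assoc (u h g') _ (u g h'), hmul_right, ite_mul, mul_ite,
      zero_mul, mul_zero] at key
    by_cases h1 : G.ColorAdj c g h <;> by_cases h2 : G'.ColorAdj c h' g' <;>
      simp_all
  · intro H g g'
    -- Each side is multiplied by a full row or column sum, which is one; both become sums of `u h
    -- g' * u g h'` and agree termwise.
    suffices hprod : (∑ h, if G.ColorAdj c g h then u h g' else 0) * ∑ h', u g h' =
        (∑ h, u h g') * ∑ h', if G'.ColorAdj c h' g' then u g h' else 0 by
      rwa [hrow, hcol, mul_one, one_mul] at hprod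
    rw [Finset.sum_mul_sum, Finset.sum_mul_sum]
    refine Finset.sum_congr rfl fun h _ => Finset.sum_congr rfl fun h' _ => ?_
    by_cases hz : u h g' * u g h' = 0
    · simp only [ite_mul, mul_ite, zero_mul, mul_zero, hz, ite_self]
    · simp only [ite_mul, mul_ite, zero_mul, mul_zero, H g g' h h' hz]

end EdgeRelation

/-! ### Tuples and spectral matrices determine each other. -/

section Correspondence

variable {m n : ℕ} {M : Matrix (Fin m) (Fin n) (ZMod 2)} {b b' : Fin m → ZMod 2}
variable {B C : Type*}

namespace IsSpectral

variable [Ring B] {x y : Fin n → B}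
  {u v : Matrix (SystemVertex M b) (SystemVertex M b') B}

theorem eq_sum (hu : IsSpectral x u) {g : SystemVertex M b} {i : Fin n}
    (hi : i ∈ eqSupport M g.1) : x i = ∑ g', entrySign g g' i • u g g' := by
  rw [← mul_one (x i), ← hu.row_sum g, Finset.mul_sum]
  exact Finset.sum_congr rfl fun g' _ => hu.mul_left g g' i hi

/-- A spectral matrix determines the tuple, if every variable occurs in an equation. -/
theorem tuple_unique (hM : ∀ i : Fin n, ∃ k : Fin m, M k i = 1) (hx : IsSpectral x u)
    (hy : IsSpectral y u) : x = y := by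
  funext i
  obtain ⟨k, hk⟩ := hM i
  have hi : i ∈ eqSupport M k := Finset.mem_filter.2 ⟨Finset.mem_univ i, hk⟩
  obtain ⟨g, rfl⟩ := exists_systemVertex b (Or.inl ⟨i, hi⟩)
  rw [hx.eq_sum hi, hy.eq_sum hi]

theorem map {F : Type*} [Ring C] [FunLike F B C] [RingHomClass F B C]
    (hu : IsSpectral x u) (φ : F) : IsSpectral (fun i => φ (x i)) (u.map φ) where
  eq_zero g g' h := by rw [Matrix.map_apply, hu.eq_zero g g' h, map_zero]
  mul_left g g' i hi := by
    rw [Matrix.map_apply, ← map_mul, hu.mul_left g g' i hi, Units.smul_def, map_zsmul,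
      Units.smul_def]
  mul_right g g' i hi := by
    rw [Matrix.map_apply, ← map_mul, hu.mul_right g g' i hi, Units.smul_def, map_zsmul,
      Units.smul_def]
  col_sum g' := by simp only [Matrix.map_apply, ← map_sum, hu.col_sum, map_one]
  row_sum g := by simp only [Matrix.map_apply, ← map_sum, hu.row_sum, map_one]

/-- The involution exchanges left and right eigenvector equations and fixes signs. With
`matrix_unique` this makes the entries self-adjoint. -/
theorem map_star [StarRing B] (hu : IsSpectral x u) (hx : ∀ i, star (x i) = x i) :
    IsSpectral x (u.map star) where
  eq_zero g g' h := by rw [Matrix.map_apply, hu.eq_zero g g' h, star_zero]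
  mul_left g g' i hi := by
    rw [Matrix.map_apply, ← hx i, ← star_mul, hu.mul_right g g' i hi, Units.smul_def, star_zsmul,
      Units.smul_def]
  mul_right g g' i hi := by
    rw [Matrix.map_apply, ← hx i, ← star_mul, hu.mul_left g g' i hi, Units.smul_def, star_zsmul,
      Units.smul_def]
  col_sum g' := by simp only [Matrix.map_apply, ← star_sum, hu.col_sum, star_one]
  row_sum g := by simp only [Matrix.map_apply, ← star_sum, hu.row_sum, star_one]

variable [Algebra ℂ B]

/-- The product of two entries of spectral matrices of the same tuple vanishes unless the signs
agree on the common variables. -/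
theorem mul_eq_zero (hu : IsSpectral x u) (hv : IsSpectral x v) {g h : SystemVertex M b}
    {g' h' : SystemVertex M b'} {i : Fin n} (hg : i ∈ eqSupport M g.1) (hh : i ∈ eqSupport M h.1)
    (hs : entrySign g g' i ≠ entrySign h h' i) : u g g' * v h h' = 0 :=
  mul_eq_zero_of_sign_ne (hu.mul_right g g' i hg) (hv.mul_left h h' i hh) hs

/-- Different columns of the same color give different signs at some variable of the equation.
Allowing two matrices `u`, `v` serves both idempotence (`v = u`) and uniqueness. -/
theorem row_orthogonal (hu : IsSpectral x u) (hv : IsSpectral x v) (g : SystemVertex M b)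
    (g' h' : SystemVertex M b') (hne : g' ≠ h') : u g g' * v g h' = 0 := by
  by_cases hg : g.1 = g'.1
  · by_cases hh : g.1 = h'.1
    · by_contra h0
      refine hne (entrySign_right_injective hg hh fun i hi => ?_)
      by_contra hs
      exact h0 (hu.mul_eq_zero hv hi hi hs)
    · rw [hv.eq_zero _ _ hh, mul_zero]
  · rw [hu.eq_zero _ _ hg, zero_mul]

theorem col_orthogonal (hu : IsSpectral x u) (hv : IsSpectral x v) (g h : SystemVertex M b)
    (g' : SystemVertex M b') (hne : g ≠ h) : u g g' * v h g' = 0 := by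
  by_cases hg : g.1 = g'.1
  · by_cases hh : h.1 = g'.1
    · by_contra h0
      refine hne (entrySign_left_injective hg hh fun i hi => ?_)
      by_contra hs
      exact h0 (hu.mul_eq_zero hv hi (by rwa [hh, ← hg]) hs)
    · rw [hv.eq_zero _ _ hh, mul_zero]
  · rw [hu.eq_zero _ _ hg, zero_mul]

/-- Multiplying `u g g'` by row `g` of `v`, which sums to one, leaves only the entry at `g'`. -/
theorem mul_eq_left (hu : IsSpectral x u) (hv : IsSpectral x v) (g : SystemVertex M b)
    (g' : SystemVertex M b') : u g g' * v g g' = u g g' := by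
  conv_rhs => rw [← mul_one (u g g'), ← hv.row_sum g, Finset.mul_sum,
    Fintype.sum_eq_single g' fun h' hne => hu.row_orthogonal hv g g' h' hne.symm]

theorem mul_eq_right (hu : IsSpectral x u) (hv : IsSpectral x v) (g : SystemVertex M b)
    (g' : SystemVertex M b') : u g g' * v g g' = v g g' := by
  conv_rhs => rw [← one_mul (v g g'), ← hu.row_sum g, Finset.sum_mul,
    Fintype.sum_eq_single g' fun h' hne => hu.row_orthogonal hv g h' g' hne]

/-- A tuple has at most one spectral matrix. -/
theorem matrix_unique (hu : IsSpectral x u) (hv : IsSpectral x v) : u = v := by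
  ext g g'
  rw [← hu.mul_eq_left hv, hu.mul_eq_right hv]

theorem isIsoRep [StarRing B] (hu : IsSpectral x u) (hx : ∀ i, star (x i) = x i) :
    IsIsoRep (systemGraph M b) (systemGraph M b') u where
  mul_self := hu.mul_eq_left hu
  star_self g g' := (congrFun₂ (hu.matrix_unique (hu.map_star hx)) g g').symm
  col_sum := hu.col_sum
  row_sum := hu.row_sum
  vertex_color g g' h := hu.eq_zero g g' fun hg => h (congrArg Sum.inl hg)
  edge_color c := by
    refine (edge_relation_iff hu.col_sum hu.row_sum (hu.mul_eq_left hu)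
      (hu.col_orthogonal hu) (hu.row_orthogonal hu) c).2 fun g g' h h' hne => ?_
    have hh : h.1 = g'.1 := by
      by_contra h0
      exact hne (by rw [hu.eq_zero _ _ h0, zero_mul])
    have hg : g.1 = h'.1 := by
      by_contra h0
      exact hne (by rw [hu.eq_zero _ _ h0, mul_zero])
    have hsign : signProduct g h = signProduct h' g' :=
      (signProduct_eq_iff hg hh).2 fun i hi hj => by
        by_contra hs
        exact hne (hu.mul_eq_zero hu hj hi fun he => hs (Int.units_mul_exchange _ _ _ _ he))
    -- Adjacency includes being distinct, so equal edge colors alone do not suffice.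
    have hdiag : g = h ↔ h' = g' := by
      constructor
      · rintro rfl
        by_contra h0
        exact hne (hu.row_orthogonal hu _ _ _ (Ne.symm h0))
      · rintro rfl
        by_contra h0
        exact hne (hu.col_orthogonal hu _ _ _ (Ne.symm h0))
    rw [colorAdj_systemGraph_iff, colorAdj_systemGraph_iff, hsign, Ne, hdiag, hg, hh]

end IsSpectral

end Correspondence

/-! ### Existence of spectral matrices and of tuples. -/

section Existence

variable {m n : ℕ} {M : Matrix (Fin m) (Fin n) (ZMod 2)} {b b' : Fin m → ZMod 2} {B : Type*}

theorem mem_eqSupport {k : Fin m} {i : Fin n} : i ∈ eqSupport M k ↔ M k i = 1 := by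
  simp [eqSupport]

theorem prod_eqSupport_sort (s : Fin n → ℤˣ) (k : Fin m) :
    (((eqSupport M k).sort (· ≤ ·)).map s).prod = ∏ i ∈ eqSupport M k, s i := by
  rw [← Finset.prod_map_toList]
  exact ((Finset.sort_perm_toList _ _).map s).prod_eq

/-- A tuple that satisfies the relations of `A(M, b + b')` has a spectral matrix. -/
theorem IsSystemRep.exists_isSpectral [Ring B] [StarRing B] [Algebra ℂ B] {x : Fin n → B}
    (hx : IsSystemRep M (b + b') x) :
    ∃ u : Matrix (SystemVertex M b) (SystemVertex M b') B, IsSpectral x u := by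
  choose P hPl hPr hPsum using fun k : Fin m =>
    exists_joint_spectral (fun i : eqSupport M k => x i) (fun i => hx.mul_self i)
      fun i j => hx.comm k i j (mem_eqSupport.1 i.2) (mem_eqSupport.1 j.2)
  -- The product of the `x i` acts on `P k s` both by `∏ i, s i` and, through the relation, by
  -- `(-1)^((b + b') k)`.
  have hzero : ∀ k (s : eqSupport M k → ℤˣ), ∏ i, s i ≠ (-1) ^ ((b + b') k).val → P k s = 0 := by
    intro k s hs
    have hext : ∀ i : eqSupport M k, Function.extend Subtype.val s 1 (i : Fin n) = s i := fun i =>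
      Subtype.val_injective.extend_apply s 1 i
    have h := list_prod_mul_eq_smul (x := x) (p := P k s) (s := Function.extend Subtype.val s 1)
      ((eqSupport M k).sort (· ≤ ·)) fun i hi => by
        have hi' : i ∈ eqSupport M k := (Finset.mem_sort _).1 hi
        rw [hext ⟨i, hi'⟩]
        exact hPl k ⟨i, hi'⟩ s
    rw [hx.prod, prod_eqSupport_sort, ← Finset.prod_coe_sort] at h
    simp only [hext] at h
    rw [← Int.units_smul_one_neg_one_pow, smul_one_mul] at h
    exact (Int.units_smul_eq_iff_of_ne hs).1 h.symm
  let u : Matrix (SystemVertex M b) (SystemVertex M b') B := fun g g' =>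
    if g.1 = g'.1 then P g.1 fun i => entrySign g g' i else 0
  have hu : ∀ g g', g.1 = g'.1 → u g g' = P g.1 fun i => entrySign g g' i := fun g g' h => if_pos h
  have hu' : ∀ g g', g.1 = g'.1 → u g g' = P g'.1 fun i => entrySign g g' i := by
    rintro ⟨k, α⟩ ⟨l, β⟩ h
    obtain rfl : k = l := h
    exact hu _ _ rfl
  have hu0 : ∀ g g', g.1 ≠ g'.1 → u g g' = 0 := fun g g' h => if_neg h
  have hcancel : ∀ s t : ℤˣ, s * (s * t) = t := by decide
  have hcancel' : ∀ s t : ℤˣ, t * s * s = t := by decide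
  refine ⟨u, hu0, fun g g' i hi => ?_, fun g g' i hi => ?_, fun g' => ?_, fun g => ?_⟩
  · by_cases h : g.1 = g'.1
    · rw [hu _ _ h]; exact hPl g.1 ⟨i, hi⟩ _
    · rw [hu0 _ _ h, mul_zero, smul_zero]
  · by_cases h : g.1 = g'.1
    · rw [hu _ _ h]; exact hPr g.1 ⟨i, hi⟩ _
    · rw [hu0 _ _ h, zero_mul, smul_zero]
  · rw [← hPsum g'.1, Fintype.sum_sigma, Fintype.sum_eq_single g'.1]
    -- The map `α ↦ α △ β` is injective, and any sign function outside its image has the wrong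
    -- product, so its projection is zero.
    · refine Fintype.sum_of_injective
        (fun (α : SignFun (eqSupport M g'.1) (b g'.1)) (i : eqSupport M g'.1) =>
          entrySign ⟨g'.1, α⟩ g' i) ?_ _ _ ?_ ?_
      · intro α β h
        have := entrySign_left_injective (g := ⟨g'.1, α⟩) (h := ⟨g'.1, β⟩) (g' := g') rfl rfl
          fun i hi => congrFun h ⟨i, hi⟩
        simpa using this
      · intro s hs
        -- A sign function with the right product is hit: signs are their own inverses, so `α = s △
        -- β`.
        refine hzero _ _ fun hprod => hs ⟨⟨fun i => s i * vertexSign g' i, ?_⟩, ?_⟩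
        · rw [Finset.prod_mul_distrib, hprod, Finset.prod_coe_sort _ (vertexSign g'),
            prod_vertexSign, Pi.add_apply, neg_one_pow_val_add, hcancel']
        · funext i
          exact (congrArg (· * vertexSign g' i)
            (vertexSign_coe (b := b) ⟨g'.1, _⟩ i)).trans (hcancel' _ _)
      · intro α
        exact hu' _ _ rfl
    · intro k hk
      exact Finset.sum_eq_zero fun α _ => hu0 _ _ hk
  · rw [← hPsum g.1, Fintype.sum_sigma, Fintype.sum_eq_single g.1]
    · refine Fintype.sum_of_injective
        (fun (α : SignFun (eqSupport M g.1) (b' g.1)) (i : eqSupport M g.1) =>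
          entrySign g ⟨g.1, α⟩ i) ?_ _ _ ?_ ?_
      · intro α β h
        have := entrySign_right_injective (g := g) (g' := ⟨g.1, α⟩) (h' := ⟨g.1, β⟩) rfl rfl
          fun i hi => congrFun h ⟨i, hi⟩
        simpa using this
      · intro s hs
        refine hzero _ _ fun hprod => hs ⟨⟨fun i => vertexSign g i * s i, ?_⟩, ?_⟩
        · rw [Finset.prod_mul_distrib, hprod, Finset.prod_coe_sort _ (vertexSign g),
            prod_vertexSign, Pi.add_apply, neg_one_pow_val_add, hcancel]
        · funext i
          exact (congrArg (vertexSign g i * ·)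
            (vertexSign_coe (b := b') ⟨g.1, _⟩ i)).trans (hcancel _ _)
      · intro α
        exact hu _ _ rfl
    · intro k hk
      exact Finset.sum_eq_zero fun α _ => hu0 _ _ hk.symm

theorem eq_of_mul_eq_of_sum_eq_one {B ι : Type*} [Ring B] [Fintype ι] {p : ι → B} {a c : B}
    (hsum : ∑ i, p i = 1) (h : ∀ i, a * p i = c * p i) : a = c := by
  have := Finset.sum_congr rfl fun i (_ : i ∈ Finset.univ) => h i
  rwa [← Finset.mul_sum, ← Finset.mul_sum, hsum, mul_one, mul_one] at this

/-- Apart from self-adjointness, which comes from `eq_sum`, the relations are tested on the entries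
of one row or column: these sum to one, and the variables act on them by signs. -/
theorem IsSpectral.isSystemRep [Ring B] [StarRing B] [Algebra ℂ B]
    (hM : ∀ i : Fin n, ∃ k : Fin m, M k i = 1) {x : Fin n → B}
    {u : Matrix (SystemVertex M b) (SystemVertex M b') B} (hu : IsSpectral x u)
    (hstar : ∀ g g', star (u g g') = u g g') : IsSystemRep M (b + b') x := by
  have hvertex : ∀ k i, M k i = 1 → ∃ g : SystemVertex M b, g.1 = k ∧ i ∈ eqSupport M g.1 :=
    fun k i hi => by
      obtain ⟨g, rfl⟩ := exists_systemVertex b (Or.inl ⟨i, mem_eqSupport.2 hi⟩)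
      exact ⟨g, rfl, mem_eqSupport.2 hi⟩
  have hprod : ∀ g g', (((eqSupport M g.1).sort (· ≤ ·)).map x).prod * u g g' =
      (-1) ^ ((b + b') g.1).val * u g g' := fun g g' => by
    by_cases h : g.1 = g'.1
    · rw [list_prod_mul_eq_smul _ fun i hi => hu.mul_left g g' i ((Finset.mem_sort _).1 hi),
        prod_eqSupport_sort, prod_entrySign h, ← Int.units_smul_one_neg_one_pow, smul_one_mul]
    · rw [hu.eq_zero g g' h, mul_zero, mul_zero]
  refine ⟨fun i => ?_, fun i => ?_, fun k i j hi hj => ?_, fun k => ?_⟩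
  · obtain ⟨k, hk⟩ := hM i
    obtain ⟨g, -, hi⟩ := hvertex k i hk
    rw [hu.eq_sum hi, star_sum]
    refine Finset.sum_congr rfl fun g' _ => ?_
    rw [Units.smul_def, star_zsmul, hstar]
  · obtain ⟨k, hk⟩ := hM i
    obtain ⟨g, -, hi⟩ := hvertex k i hk
    refine eq_of_mul_eq_of_sum_eq_one (hu.row_sum g) fun g' => ?_
    rw [mul_assoc, hu.mul_left g g' i hi, mul_smul_comm, hu.mul_left g g' i hi,
      Int.units_smul_smul_self, one_mul]
  · obtain ⟨g, rfl, hi'⟩ := hvertex k i hi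
    rw [← mem_eqSupport] at hj
    refine eq_of_mul_eq_of_sum_eq_one (hu.row_sum g) fun g' => ?_
    rw [mul_assoc, hu.mul_left g g' j hj, mul_smul_comm, hu.mul_left g g' i hi', mul_assoc,
      hu.mul_left g g' i hi', mul_smul_comm, hu.mul_left g g' j hj, smul_comm]
  · by_cases hg : ∃ g : SystemVertex M b, g.1 = k
    · obtain ⟨g, rfl⟩ := hg
      exact eq_of_mul_eq_of_sum_eq_one (hu.row_sum g) (hprod g)
    -- If only `G(M, b')` has a vertex of color `k`, its column is zero yet sums to one, so `B` is
    -- trivial. If neither graph has one, the equation is empty and `b k = b' k = 1`, so it reads `1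
    -- = 1`.
    by_cases hg' : ∃ g' : SystemVertex M b', g'.1 = k
    · obtain ⟨g', rfl⟩ := hg'
      refine eq_of_mul_eq_of_sum_eq_one (hu.col_sum g') fun h => ?_
      rw [hu.eq_zero h g' fun he => hg ⟨h, he⟩, mul_zero, mul_zero]
    have hS : eqSupport M k = ∅ := Finset.not_nonempty_iff_eq_empty.1 fun hne =>
      hg (exists_systemVertex b (Or.inl hne))
    have hone : ∀ c d : ZMod 2, c ≠ 0 → d ≠ 0 → c + d = 0 := by decide
    have hbb : (b + b') k = 0 := hone _ _ (fun h => hg (exists_systemVertex b (Or.inr h)))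
      fun h => hg' (exists_systemVertex b' (Or.inr h))
    simp [hS, hbb]

/-- A matrix in a C⋆-algebra that satisfies the relations of the isomorphism algebra is
spectral for some tuple. -/
theorem IsIsoRep.exists_isSpectral [CStarAlgebra B]
    (hM : ∀ i : Fin n, ∃ k : Fin m, M k i = 1)
    {u : Matrix (SystemVertex M b) (SystemVertex M b') B}
    (hu : IsIsoRep (systemGraph M b) (systemGraph M b') u) :
    ∃ x : Fin n → B, IsSpectral x u := by
  have hrow : ∀ g g' h', g' ≠ h' → u g g' * u g h' = 0 := fun g g' h' hne =>
    mul_eq_zero_of_sum_eq_one (hu.mul_self g) (hu.star_self g) (hu.row_sum g) hne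
  have hcol : ∀ g h g', g ≠ h → u g g' * u h g' = 0 := fun g h g' hne =>
    mul_eq_zero_of_sum_eq_one (fun k => hu.mul_self k g') (fun k => hu.star_self k g')
      (hu.col_sum g') hne
  have hzero : ∀ (g : SystemVertex M b) (g' : SystemVertex M b'), g.1 ≠ g'.1 → u g g' = 0 :=
    fun g g' h => hu.vertex_color g g' fun he => h (Sum.inl_injective he)
  have hedge := fun c => (edge_relation_iff hu.col_sum hu.row_sum hu.mul_self hcol hrow c).1
    (hu.edge_color c)
  -- Key consequence of the edge relations: entries with a nonzero product give each common variable
  -- the same sign. For `h = g` this is row orthogonality; otherwise the common variable makes `h`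
  -- and `g` adjacent, and their edge color is preserved.
  have hsign : ∀ (g h : SystemVertex M b) (g' h' : SystemVertex M b') (i : Fin n),
      i ∈ eqSupport M g.1 → i ∈ eqSupport M h.1 → u g g' * u h h' ≠ 0 →
      entrySign g g' i = entrySign h h' i := by
    intro g h g' h' i hg hh hne
    have hgg : g.1 = g'.1 := by
      by_contra h0
      exact hne (by rw [hzero _ _ h0, zero_mul])
    have hhh : h.1 = h'.1 := by
      by_contra h0
      exact hne (by rw [hzero _ _ h0, mul_zero])
    by_cases heq : h = g
    · subst heq
      have : g' = h' := by
        by_contra h0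
        exact hne (hrow _ _ _ h0)
      rw [this]
    · have hadj := (hedge _ h g' g h' hne).1 (colorAdj_systemGraph_iff.2
        ⟨⟨heq, ⟨i, Finset.mem_inter.2 ⟨hh, hg⟩⟩⟩, rfl⟩)
      have hsp := Sum.inr_injective (colorAdj_systemGraph_iff.1 hadj).2
      exact (Int.units_mul_exchange _ _ _ _
        ((signProduct_eq_iff hhh hgg).1 hsp.symm i hh hg).symm).symm
  choose k hk using hM
  -- An arbitrary row `v i` whose equation contains `i`; `hsign` makes the choice immaterial.
  choose v hv using fun i => exists_systemVertex b (Or.inl ⟨i, mem_eqSupport.2 (hk i)⟩)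
  have hmem : ∀ i, i ∈ eqSupport M (v i).1 := fun i => by rw [hv]; exact mem_eqSupport.2 (hk i)
  refine ⟨fun i => ∑ h', entrySign (v i) h' i • u (v i) h', hzero, fun g g' i hi => ?_,
    fun g g' i hi => ?_, hu.col_sum, hu.row_sum⟩
  -- After expanding `1` along row `v i`, only products `u (v i) h' * u g g'` with matching sign
  -- survive.
  · conv_rhs => rw [← one_mul (u g g'), ← hu.row_sum (v i), Finset.sum_mul, Finset.smul_sum]
    rw [Finset.sum_mul]
    refine Finset.sum_congr rfl fun h' _ => ?_
    rw [smul_mul_assoc]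
    by_cases h0 : u (v i) h' * u g g' = 0
    · rw [h0, smul_zero, smul_zero]
    · rw [hsign _ _ _ _ i (hmem i) hi h0]
  · conv_rhs => rw [← mul_one (u g g'), ← hu.row_sum (v i), Finset.mul_sum, Finset.smul_sum]
    rw [Finset.mul_sum]
    refine Finset.sum_congr rfl fun h' _ => ?_
    rw [mul_smul_comm]
    by_cases h0 : u g g' * u (v i) h' = 0
    · rw [h0, smul_zero, smul_zero]
    · rw [hsign _ _ _ _ i hi (hmem i) h0]

end Existence

/-! ### Homomorphisms out of the two universal algebras. -/

section Isomorphism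

variable {m n : ℕ} {M : Matrix (Fin m) (Fin n) (ZMod 2)} {c b b' : Fin m → ZMod 2}

theorem isSystemRep_gen :
    IsSystemRep M c (fun i => UniversalCStarAlgebra.gen (systemRelations M c) i) :=
  (isSystemRep_iff c (UniversalCStarAlgebra.ofFreeHom (systemRelations M c))).2
    fun _ _ h => UniversalCStarAlgebra.ofFreeHom_eq_of_rel _ h

theorem IsSystemRep.exists_starAlgHom {B : Type*} [CStarAlgebra B] {x : Fin n → B}
    (hx : IsSystemRep M c x) : ∃ φ : SystemAlgebra M c →⋆ₐ[ℂ] B,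
      ∀ i, φ (UniversalCStarAlgebra.gen _ i) = x i := by
  have hgen : (fun i => FreeStarAlgebra.lift x (FreeStarAlgebra.gen i)) = x :=
    funext (FreeStarAlgebra.lift_gen x)
  have hrel : ∀ p q, (systemRelations M c).rel p q →
      FreeStarAlgebra.lift x p = FreeStarAlgebra.lift x q :=
    (isSystemRep_iff c _).1 (by rwa [hgen])
  exact ⟨UniversalCStarAlgebra.lift (FreeStarAlgebra.lift x) hrel, fun i =>
    (UniversalCStarAlgebra.lift_gen _ hrel i).trans (FreeStarAlgebra.lift_gen x i)⟩

variable {V V' S : Type*} [Fintype V] [Fintype V'] (G : ColoredGraph V S) (G' : ColoredGraph V' S)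

/-- The matrix of the generators of the isomorphism algebra. -/
def isoGenMatrix : Matrix V V' (IsoAlgebra G G') :=
  Matrix.of fun g g' => UniversalCStarAlgebra.gen (isoRelations G G') (g, g')

theorem isIsoRep_gen : IsIsoRep G G' (isoGenMatrix G G') :=
  (isIsoRep_iff (UniversalCStarAlgebra.ofFreeHom (isoRelations G G'))).2
    fun _ _ h => UniversalCStarAlgebra.ofFreeHom_eq_of_rel _ h

variable {G G'}

theorem IsIsoRep.exists_starAlgHom {B : Type*} [CStarAlgebra B] {u : Matrix V V' B}
    (hu : IsIsoRep G G' u) : ∃ φ : IsoAlgebra G G' →⋆ₐ[ℂ] B, (isoGenMatrix G G').map φ = u := by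
  have hgen : (genMatrix V V').map (FreeStarAlgebra.lift fun a : V × V' => u a.1 a.2) = u := by
    ext g g'
    exact FreeStarAlgebra.lift_gen (fun a : V × V' => u a.1 a.2) (g, g')
  have hrel : ∀ p q, (isoRelations G G').rel p q →
      FreeStarAlgebra.lift (fun a : V × V' => u a.1 a.2) p =
        FreeStarAlgebra.lift (fun a : V × V' => u a.1 a.2) q :=
    (isIsoRep_iff _).1 (by rwa [hgen])
  refine ⟨UniversalCStarAlgebra.lift _ hrel, ?_⟩
  ext g g'
  exact (UniversalCStarAlgebra.lift_gen _ hrel (g, g')).trans (FreeStarAlgebra.lift_gen _ _)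

end Isomorphism

end

theorem theorem6p6 {m n : ℕ} (M : Matrix (Fin m) (Fin n) (ZMod 2)) (b b' : Fin m → ZMod 2)
    (hM : ∀ i : Fin n, ∃ k : Fin m, M k i = 1) (hb : b ≠ b') :
    Nonempty (SystemAlgebra M (b + b') ≃⋆ₐ[ℂ]
      IsoAlgebra (systemGraph M b) (systemGraph M b')) := by
  have hx := isSystemRep_gen (M := M) (c := b + b')
  have hu := isIsoRep_gen (systemGraph M b) (systemGraph M b')
  obtain ⟨v, hxv⟩ := hx.exists_isSpectral
  obtain ⟨y, hyu⟩ := hu.exists_isSpectral hM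
  obtain ⟨φ, hφ⟩ := (hyu.isSystemRep hM hu.star_self).exists_starAlgHom
  obtain ⟨ψ, hψ⟩ := (hxv.isIsoRep hx.star_self).exists_starAlgHom
  refine ⟨StarAlgEquiv.ofStarAlgHom φ ψ (UniversalCStarAlgebra.starAlgHom_ext fun i => ?_)
    (UniversalCStarAlgebra.starAlgHom_ext fun a => ?_)⟩
  -- Since `ψ` sends the generating matrix to `v`, both `ψ ∘ y` and the generating tuple are
  -- spectral for `v`.
  · have hψy := hyu.map ψ
    rw [hψ] at hψy
    change ψ (φ _) = _
    rw [hφ]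
    exact congrFun (hψy.tuple_unique hM hxv) i
  -- Since `φ` sends the generating tuple to `y`, both the image of `v` and the generating matrix
  -- are spectral for `y`.
  · have hφv := hxv.map φ
    simp only [hφ] at hφv
    have hvu := hφv.matrix_unique hyu
    rw [← hψ] at hvu
    exact congrFun₂ hvu a.1 a.2
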